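/- **Lemma.** Let $\hat f:\mathbb R^n\to\mathbb R$ be twice continuously differentiable and $\alpha$-strongly convex for some $\alpha>0$, with $\beta$-Lipschitz gradient $\nabla\hat f$. Let $c:\mathbb R_{\ge 0}\to\mathbb R^n$ and $v:\mathbb R_{\ge 0}\to\mathbb R^m$ be $\ell_c$- and $\ell_v$-Lipschitz continuous, respectively. Let $U\in\mathbb R^{m\times n}$, and put $\hat{\mathcal X}(t):=\{x\in\mathbb R^n \mid Ux\le v(t)\}$ (componentwise inequality), assumed non-empty for every $t\ge 0$. Suppose there is $\omega>0$ such that for every $t\ge 0$ and every $x\in\hat{\mathcal X}(t)$, $$\omega^2\,\mathbb I\preceq U_{I}U_{I}^{\top},\qquad I=I(x,t):=\{i \mid (Ux)_i=v_i(t)\},$$ where $U_I$ consists of the rows of $U$ with index in $I$ (the condition is void if $I=\emptyset$). For $x\in\hat{\mathcal X}(t)$ let $N_x\hat{\mathcal X}(t):=\operatorname{cl}\{\eta\mid \langle\eta,y-x\rangle\le 0 \text{ for all } y\in\hat{\mathcal X}(t)\}$ be the normal cone. A *complete solution* of the sweeping gradient flow $$\dot x(t)\in-\nabla\hat f(x(t)-c(t))-N_{x(t)}\hat{\mathcal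 X}(t)$$ is a map $x:\mathbb R_{\ge 0}\to\mathbb R^n$ such that for every $T>0$, $x$ is absolutely continuous on $[0,T]$, satisfies the inclusion for almost every $t\in[0,T]$, and satisfies $x(t)\in\hat{\mathcal X}(t)$ for all $t\in[0,T]$. Then for every $x_0\in\hat{\mathcal X}(0)$ the sweeping gradient flow admits exactly one complete solution with $x(0)=x_0$. -/

import Mathlib

open Set MeasureTheory
open scoped NNReal Matrix Gradient

namespace Sweeping

/-- The normal cone `N_x X` of a (non-empty convex) set `X` at a point `x ∈ X`. -/
def normalCone {n : ℕ} (X : Set (EuclideanSpace ℝ (Fin n))) (x : EuclideanSpace ℝ (Fin n)) :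
    Set (EuclideanSpace ℝ (Fin n)) :=
  closure {η | ∀ y ∈ X, inner ℝ η (y - x) ≤ 0}

/-- `x` is a solution on `[0, T]` of the perturbed sweeping process
`x'(t) ∈ Φ(x(t), t) - N_{x(t)} X(t)`, `x(0) ∈ X(0)`. Only the values of `x`
on `[0, T]` matter. -/
structure IsSolution {n : ℕ}
    (Φ : EuclideanSpace ℝ (Fin n) → ℝ → EuclideanSpace ℝ (Fin n))
    (X : ℝ → Set (EuclideanSpace ℝ (Fin n))) (T : ℝ)
    (x : ℝ → EuclideanSpace ℝ (Fin n)) : Prop where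
  absolutelyContinuous : AbsolutelyContinuousOnInterval x 0 T
  inclusion : ∀ᵐ t ∂(volume.restrict (Icc 0 T)),
    ∃ η ∈ normalCone (X t) (x t), HasDerivWithinAt x (Φ (x t) t - η) (Icc 0 T) t
  mem : ∀ t ∈ Icc 0 T, x t ∈ X t

/-- `x` is a complete solution (on `[0, ∞)`) of the perturbed sweeping process: its restriction
to every compact interval `[0, T]`, `T > 0`, is a solution (in particular it is absolutely
continuous on every such interval). Only the values of `x` on `[0, ∞)` matter. -/
def IsCompleteSolution {n : ℕ}
    (Φ : EuclideanSpace ℝ (Fin n) → ℝ → EuclideanSpace ℝ (Fin n))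
    (X : ℝ → Set (EuclideanSpace ℝ (Fin n)))
    (x : ℝ → EuclideanSpace ℝ (Fin n)) : Prop :=
  ∀ T : ℝ, 0 < T → IsSolution Φ X T x

/-- The polyhedron `{x | U x ≤ b}`. -/
def polyhedron {m n : ℕ} (U : Matrix (Fin m) (Fin n) ℝ) (b : EuclideanSpace ℝ (Fin m)) :
    Set (EuclideanSpace ℝ (Fin n)) :=
  {x | ∀ i, (U *ᵥ x.ofLp) i ≤ b i}

/-- The indices of the constraints of `U x ≤ b` that are active at `x`. -/
def activeSet {m n : ℕ} (U : Matrix (Fin m) (Fin n) ℝ) (b : EuclideanSpace ℝ (Fin m))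
    (x : EuclideanSpace ℝ (Fin n)) : Set (Fin m) :=
  {i | (U *ᵥ x.ofLp) i = b i}

/-- The submatrix `U_I` of the rows of `U` with index in `I`. -/
def rowSubmatrix {m n : ℕ} (U : Matrix (Fin m) (Fin n) ℝ) (I : Set (Fin m)) :
    Matrix I (Fin n) ℝ :=
  U.submatrix Subtype.val id

end Sweeping

namespace Sweeping

open Filter Topology

/-! Uniqueness is Grönwall's inequality: normal cones are monotone and the perturbation is
Lipschitz, so `‖x - y‖²` grows at most at rate `2β`.

Existence is Moreau's catching-up scheme: take an explicit Euler step, then project onto the next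
set. This needs the sets to move with finite speed, which is a Hoffman bound: the displacement from
a point to its projection is a nonnegative combination of active rows, and the lower bound `ω ^ 2`
on their Gram matrix controls its coefficients (`exists_mem_polyhedron_norm_sub_le`).

The scheme is then uniformly Lipschitz up to the step size (`rate_le`). Summing the variational
inequalities of the projections gives, over a time span `δ`, an inequality with error of order `δ *
(δ + h)` (`inner_sub_ge`). It survives pointwise limits, so no weak convergence of derivatives is
needed; dividing the resulting `δ ^ 2` error by `δ` yields the inclusion wherever the limit is
differentiable. -/

/-- The Lipschitz constant on `[0, T]` of the sequences produced by the catching-up algorithm. -/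
noncomputable def speedBound {E : Type*} [NormedAddCommGroup E] (Φ : E → ℝ → E) (κ β γ : ℝ) (x₀ : E) (T : ℝ) : ℝ :=
  Real.exp ((2 * β + 1) * T) * (κ + 2 * ‖Φ x₀ 0‖ + 2 * γ)

lemma speedBound_nonneg {E : Type*} [NormedAddCommGroup E] {Φ : E → ℝ → E} {κ β γ : ℝ} (hκ : 0 ≤ κ) (hγ : 0 ≤ γ) (x₀ : E)
    (T : ℝ) : 0 ≤ speedBound Φ κ β γ x₀ T := by
  unfold speedBound; positivity

/-! ### Catching-up scheme: discrete estimates. -/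

section CatchingUp

variable {E : Type*} [NormedAddCommGroup E] [InnerProductSpace ℝ E]

/-- A closed convex set contains a nearest point to each `u`, characterised by the variational
inequality. -/
lemma exists_nearest_point [CompleteSpace E] {K : Set E} (hne : K.Nonempty) (hcl : IsClosed K)
    (hcv : Convex ℝ K) (u : E) :
    ∃ p ∈ K, (∀ z ∈ K, ‖u - p‖ ≤ ‖u - z‖) ∧ ∀ z ∈ K, inner ℝ (u - p) (z - p) ≤ 0 := by
  obtain ⟨p, hp, hmin⟩ := exists_norm_eq_iInf_of_complete_convex hne hcl.isComplete hcv u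
  refine ⟨p, hp, fun z hz => ?_, (norm_eq_iInf_iff_real_inner_le_zero hcv hp).1 hmin⟩
  rw [hmin]
  exact ciInf_le ⟨0, by rintro _ ⟨w, rfl⟩; exact norm_nonneg _⟩ (⟨z, hz⟩ : K)

/-- `X` moves with speed at most `κ` on `[0, ∞)`, in the Hausdorff distance. -/
def MovesWithSpeed (X : ℝ → Set E) (κ : ℝ) : Prop :=
  ∀ s t : ℝ, 0 ≤ s → 0 ≤ t → ∀ x ∈ X s, ∃ z ∈ X t, ‖z - x‖ ≤ κ * |t - s|

/-- `Φ` is Lipschitz in space, with constant `β`, and in time on `[0, ∞)`, with constant `γ`. -/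
def IsLipschitzField (Φ : E → ℝ → E) (β γ : ℝ) : Prop :=
  ∀ (x y : E) (s t : ℝ), 0 ≤ s → 0 ≤ t → ‖Φ x s - Φ y t‖ ≤ β * ‖x - y‖ + γ * |s - t|

/-- The sequences produced by Moreau's catching-up algorithm with step size `h`. -/
structure IsCatchingUp (Φ : E → ℝ → E) (X : ℝ → Set E) (κ h : ℝ) (p : ℕ → E) : Prop where
  mem : ∀ k : ℕ, p k ∈ X (k * h)
  inner_nonneg : ∀ k : ℕ, ∀ z ∈ X ((k + 1 : ℕ) * h),
    0 ≤ inner ℝ (p (k + 1) - p k - h • Φ (p k) (k * h)) (z - p (k + 1))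
  step_le : ∀ k : ℕ, ‖p (k + 1) - p k‖ ≤ h * (κ + 2 * ‖Φ (p k) (k * h)‖)

/-- Each new point is the projection of the Euler point. Some point of the next set lies within `κ *
h` of the old one; comparing the projection with it bounds the step, the Euler displacement being
counted twice. -/
lemma exists_isCatchingUp [CompleteSpace E] {Φ : E → ℝ → E} {X : ℝ → Set E} {κ h : ℝ}
    (hX : MovesWithSpeed X κ) (hcl : ∀ t, IsClosed (X t)) (hcv : ∀ t, Convex ℝ (X t))
    (hh : 0 ≤ h) {x₀ : E} (hx₀ : x₀ ∈ X 0) :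
    ∃ p : ℕ → E, p 0 = x₀ ∧ IsCatchingUp Φ X κ h p := by
  have key : ∀ (k : ℕ) (a : X (k * h)), ∃ b : X ((k + 1 : ℕ) * h),
      (∀ z ∈ X ((k + 1 : ℕ) * h), 0 ≤ inner ℝ (b.1 - a - h • Φ a (k * h)) (z - b)) ∧
      ‖b.1 - a‖ ≤ h * (κ + 2 * ‖Φ a (k * h)‖) := by
    rintro k ⟨a, ha⟩
    obtain ⟨z, hz, hza⟩ := hX (k * h) ((k + 1 : ℕ) * h) (by positivity) (by positivity) a ha
    obtain ⟨b, hb, hmin, hvar⟩ := exists_nearest_point ⟨z, hz⟩ (hcl _) (hcv _)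
      (a + h • Φ a (k * h))
    refine ⟨⟨b, hb⟩, fun w hw => ?_, ?_⟩
    · have := hvar w hw
      have e : b - a - h • Φ a (k * h) = -(a + h • Φ a (k * h) - b) := by abel
      simp only [e, inner_neg_left]
      linarith
    · have h1 := hmin z hz
      have e1 : ((k + 1 : ℕ) * h - k * h) = h := by push_cast; ring
      rw [e1, abs_of_nonneg hh] at hza
      have h2 : ‖a + h • Φ a (k * h) - z‖ ≤ h * ‖Φ a (k * h)‖ + κ * h := by
        calc ‖a + h • Φ a (k * h) - z‖ = ‖h • Φ a (k * h) - (z - a)‖ := by congr 1; abel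
          _ ≤ ‖h • Φ a (k * h)‖ + ‖z - a‖ := norm_sub_le _ _
          _ ≤ _ := by rw [norm_smul, Real.norm_of_nonneg hh]; linarith
      have h3 : ‖b - a‖ ≤ ‖h • Φ a (k * h)‖ + ‖a + h • Φ a (k * h) - b‖ := by
        calc ‖b - a‖ = ‖h • Φ a (k * h) - (a + h • Φ a (k * h) - b)‖ := by congr 1; abel
          _ ≤ _ := norm_sub_le _ _
      rw [norm_smul, Real.norm_of_nonneg hh] at h3
      change ‖b - a‖ ≤ h * (κ + 2 * ‖Φ a (k * h)‖)
      linarith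
  choose F hF1 hF2 using key
  -- Membership in `X (k * h)` is carried in the type, since the next projection depends on it.
  let q : ∀ k : ℕ, X (k * h) := fun k =>
    Nat.rec (motive := fun k => X (k * h)) ⟨x₀, by simpa using hx₀⟩ (fun k a => F k a) k
  refine ⟨fun k => (q k).1, rfl, ?_, ?_, ?_⟩
  · exact fun k => (q k).2
  · exact fun k => hF1 k (q k)
  · exact fun k => hF2 k (q k)

variable {Φ : E → ℝ → E} {X : ℝ → Set E} {κ β γ h : ℝ} {p : ℕ → E}

namespace IsCatchingUp

/-- Discrete Grönwall: one step changes `Φ` by at most `β` times the step length plus `γ * h`.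
Adding `2 * γ` to the rate makes the recursion purely multiplicative, the `+ 1` in `2 * β + 1`
absorbing the time drift. -/
lemma rate_le (hp : IsCatchingUp Φ X κ h p) (hΦ : IsLipschitzField Φ β γ)
    (hκ : 0 ≤ κ) (hβ : 0 ≤ β) (hγ : 0 ≤ γ) (hh : 0 ≤ h) {T : ℝ} {k : ℕ} (hk : k * h ≤ T) :
    κ + 2 * ‖Φ (p k) (k * h)‖ ≤ speedBound Φ κ β γ (p 0) T := by
  have main : ∀ k : ℕ, κ + 2 * ‖Φ (p k) (k * h)‖ + 2 * γ ≤ speedBound Φ κ β γ (p 0) (k * h) := by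
    intro k
    induction k with
    | zero => simp [speedBound]
    | succ k ih =>
      have h1 := hΦ (p (k + 1)) (p k) ((k + 1 : ℕ) * h) (k * h) (by positivity) (by positivity)
      have e1 : ((k + 1 : ℕ) * h - k * h) = h := by push_cast; ring
      rw [e1, abs_of_nonneg hh] at h1
      have h2 := norm_le_norm_add_norm_sub' (Φ (p (k + 1)) ((k + 1 : ℕ) * h)) (Φ (p k) (k * h))
      have h3 := mul_le_mul_of_nonneg_left (hp.step_le k) hβ
      set b := κ + 2 * ‖Φ (p k) (k * h)‖ with hb
      have hb0 : 0 ≤ b := by positivity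
      have h4 : 1 + (2 * β + 1) * h ≤ Real.exp ((2 * β + 1) * h) := by
        rw [add_comm]; exact Real.add_one_le_exp _
      have h5 : κ + 2 * ‖Φ (p (k + 1)) ((k + 1 : ℕ) * h)‖ + 2 * γ
          ≤ (1 + (2 * β + 1) * h) * (b + 2 * γ) := by
        have : 0 ≤ h * b := by positivity
        have : 0 ≤ β * h * γ := by positivity
        nlinarith
      calc _ ≤ (1 + (2 * β + 1) * h) * (b + 2 * γ) := h5
        _ ≤ Real.exp ((2 * β + 1) * h) * speedBound Φ κ β γ (p 0) (k * h) := by gcongr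
        _ = _ := by
          unfold speedBound
          rw [← mul_assoc, ← Real.exp_add]
          congr 2
          push_cast
          ring
  have h1 := main k
  have h2 : speedBound Φ κ β γ (p 0) (k * h) ≤ speedBound Φ κ β γ (p 0) T := by
    unfold speedBound; gcongr
  linarith

lemma norm_sub_le (hp : IsCatchingUp Φ X κ h p) (hΦ : IsLipschitzField Φ β γ)
    (hκ : 0 ≤ κ) (hβ : 0 ≤ β) (hγ : 0 ≤ γ) (hh : 0 ≤ h) {T : ℝ} {j k : ℕ} (hjk : j ≤ k)
    (hk : k * h ≤ T) :
    ‖p k - p j‖ ≤ (k * h - j * h) * speedBound Φ κ β γ (p 0) T := by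
  induction k, hjk using Nat.le_induction with
  | base => simp
  | succ k hjk ih =>
    have hk' : k * h ≤ T := le_trans (by push_cast; linarith) hk
    have h1 := ih hk'
    have h2 := (hp.step_le k).trans
      (mul_le_mul_of_nonneg_left (hp.rate_le hΦ hκ hβ hγ hh hk') hh)
    have h3 := norm_sub_le_norm_sub_add_norm_sub (p (k + 1)) (p k) (p j)
    push_cast
    linarith

/-- The discrete form of the differential inclusion. -/
lemma inner_sub_ge (hp : IsCatchingUp Φ X κ h p) (hX : MovesWithSpeed X κ)
    (hΦ : IsLipschitzField Φ β γ)
    (hκ : 0 ≤ κ) (hβ : 0 ≤ β) (hγ : 0 ≤ γ) (hh : 0 ≤ h) {T t δ : ℝ} {j k : ℕ} (hjk : j ≤ k)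
    (ht : 0 ≤ t) (hδ : 0 ≤ δ) (hT : t + δ ≤ T) (hj' : t ≤ (j + 1) * h)
    (hk : k * h ≤ t + δ) {z : E} (hz : z ∈ X t) :
    -((k * h - j * h) * (δ + h) *
        (2 * speedBound Φ κ β γ (p 0) T * (κ + speedBound Φ κ β γ (p 0) T) +
          (β * speedBound Φ κ β γ (p 0) T + γ) * ‖z - p j‖)) ≤
      inner ℝ (p k - p j - (k * h - j * h) • Φ (p j) (j * h)) (z - p j) := by
  set C := speedBound Φ κ β γ (p 0) T with hC
  have hC0 : 0 ≤ C := speedBound_nonneg hκ hγ _ _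
  induction k, hjk using Nat.le_induction with
  | base => simp
  | succ k hjk ih =>
    have hk1 : (k + 1) * h ≤ t + δ := by exact_mod_cast hk
    have hk' : k * h ≤ t + δ := by linarith
    have ih := ih hk'
    have hjkh : (j : ℝ) * h ≤ k * h := by gcongr
    obtain ⟨w, hw, hwz⟩ := hX t ((k + 1 : ℕ) * h) ht (by positivity) z hz
    have hwz : ‖w - z‖ ≤ κ * (δ + h) := by
      refine hwz.trans (mul_le_mul_of_nonneg_left ?_ hκ)
      rw [abs_le]; push_cast; constructor <;> linarith
    have hrate : κ + 2 * ‖Φ (p k) (k * h)‖ ≤ C := hp.rate_le hΦ hκ hβ hγ hh (hk'.trans hT)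
    have hstep : ‖p (k + 1) - p k‖ ≤ h * C :=
      (hp.step_le k).trans (mul_le_mul_of_nonneg_left hrate hh)
    have hvar := hp.inner_nonneg k w hw
    set a := p (k + 1) - p k - h • Φ (p k) (k * h) with ha_def
    have ha : ‖a‖ ≤ h * (2 * C) := by
      refine (_root_.norm_sub_le _ _).trans ?_
      rw [norm_smul, Real.norm_of_nonneg hh]
      have : ‖Φ (p k) (k * h)‖ ≤ C := by linarith [norm_nonneg (Φ (p k) (k * h))]
      nlinarith
    have hpk1 : ‖p (k + 1) - p j‖ ≤ C * (δ + h) := by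
      refine (hp.norm_sub_le hΦ hκ hβ hγ hh (by omega) (hk.trans hT)).trans ?_
      rw [mul_comm]
      refine mul_le_mul_of_nonneg_left ?_ hC0
      push_cast; linarith
    have hpk : ‖p k - p j‖ ≤ C * (δ + h) := by
      refine (hp.norm_sub_le hΦ hκ hβ hγ hh hjk (hk'.trans hT)).trans ?_
      rw [mul_comm]
      exact mul_le_mul_of_nonneg_left (by linarith) hC0
    -- The projection inequality concerns `w - p (k + 1)`. Replacing this by `z - p j` costs the
    -- motion of the set plus that of the iterates, at most `(κ + C) * (δ + h)`.
    have h1 : -(h * (2 * C) * ((κ + C) * (δ + h))) ≤ inner ℝ a (z - p j) := by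
      have e : inner ℝ a (z - p j) =
          inner ℝ a (w - p (k + 1)) + inner ℝ a ((p (k + 1) - p j) - (w - z)) := by
        rw [← inner_add_right]; congr 1; abel
      have h2 : ‖a‖ * ‖(p (k + 1) - p j) - (w - z)‖ ≤ h * (2 * C) * ((κ + C) * (δ + h)) := by
        gcongr
        refine (_root_.norm_sub_le _ _).trans ?_
        linarith
      have h3 := neg_le_of_abs_le (abs_real_inner_le_norm a ((p (k + 1) - p j) - (w - z)))
      linarith
    -- Cost of freezing `Φ` at its value at index `j`.
    have h4 : -(h * ((β * C + γ) * (δ + h)) * ‖z - p j‖) ≤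
        inner ℝ (h • (Φ (p k) (k * h) - Φ (p j) (j * h))) (z - p j) := by
      refine le_trans (neg_le_neg ?_) (neg_le_of_abs_le (abs_real_inner_le_norm _ _))
      rw [norm_smul, Real.norm_of_nonneg hh]
      gcongr
      refine (hΦ _ _ _ _ (by positivity) (by positivity)).trans ?_
      have h5 : |(k : ℝ) * h - j * h| ≤ δ + h := by rw [abs_le]; constructor <;> linarith
      have := mul_le_mul_of_nonneg_left h5 hγ
      have := mul_le_mul_of_nonneg_left hpk hβ
      linarith
    have e : p (k + 1) - p j - (((k + 1 : ℕ) : ℝ) * h - j * h) • Φ (p j) (j * h) =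
        (p k - p j - (k * h - j * h) • Φ (p j) (j * h)) + a +
          h • (Φ (p k) (k * h) - Φ (p j) (j * h)) := by
      rw [ha_def, show (((k + 1 : ℕ) : ℝ) * h - j * h) = (k * h - j * h) + h by push_cast; ring,
        add_smul, smul_sub]
      abel
    rw [e, inner_add_left, inner_add_left]
    push_cast
    linarith

end IsCatchingUp

end CatchingUp

/-! ### Passage to the limit in the step size. -/

section Limit

variable {E : Type*} [NormedAddCommGroup E] [InnerProductSpace ℝ E] [FiniteDimensional ℝ E]

/-- A pointwise limit, along an ultrafilter, of the functions produced by the catching-up algorithm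
solves the differential inclusion in an integrated form. -/
lemma exists_limit_of_catchingUp {Φ : E → ℝ → E} {X : ℝ → Set E} {κ β γ : ℝ}
    (hX : MovesWithSpeed X κ) (hcl : ∀ t, IsClosed (X t)) (hcv : ∀ t, Convex ℝ (X t))
    (hΦ : IsLipschitzField Φ β γ) (hκ : 0 ≤ κ) (hβ : 0 ≤ β) (hγ : 0 ≤ γ)
    {x₀ : E} (hx₀ : x₀ ∈ X 0) :
    ∃ x : ℝ → E, x 0 = x₀ ∧ (∀ T : ℝ, ∃ C : ℝ≥0, LipschitzOnWith C x (Icc 0 T)) ∧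
      (∀ t, 0 ≤ t → x t ∈ X t) ∧
      ∀ t, 0 ≤ t → ∀ z ∈ X t, ∃ M : ℝ, ∀ δ, 0 ≤ δ → δ ≤ 1 →
        -(δ ^ 2 * M) ≤ inner ℝ (x (t + δ) - x t - δ • Φ (x t) t) (z - x t) := by
  have : ProperSpace E := FiniteDimensional.proper ℝ E
  let h : ℕ → ℝ := fun N => 1 / ((N : ℝ) + 1)
  have hpos : ∀ N, 0 < h N := fun N => by positivity
  choose p hp0 hp using fun N => exists_isCatchingUp (Φ := Φ) hX hcl hcv (hpos N).le hx₀
  -- Index of the last grid point not after `t`.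
  let j : ℕ → ℝ → ℕ := fun N t => ⌊t / h N⌋₊
  have hj : ∀ N t, 0 ≤ t → j N t * h N ≤ t := fun N t ht =>
    (le_div_iff₀ (hpos N)).1 (Nat.floor_le (div_nonneg ht (hpos N).le))
  have hj' : ∀ N t, t ≤ (j N t + 1) * h N := fun N t =>
    (div_le_iff₀ (hpos N)).1 (Nat.lt_floor_add_one _).le
  have hjmono : ∀ N s t, s ≤ t → j N s ≤ j N t := fun N s t hst =>
    Nat.floor_le_floor (div_le_div_of_nonneg_right hst (hpos N).le)
  let C : ℝ → ℝ := speedBound Φ κ β γ x₀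
  have hC : ∀ T, 0 ≤ C T := speedBound_nonneg hκ hγ x₀
  have hlip : ∀ N s t T, 0 ≤ s → s ≤ t → t ≤ T →
      ‖p N (j N t) - p N (j N s)‖ ≤ (t - s + h N) * C T := by
    intro N s t T hs hst htT
    have h1 := hj N t (hs.trans hst)
    have h2 := (hp N).norm_sub_le hΦ hκ hβ hγ (hpos N).le (hjmono N s t hst) (h1.trans htT)
    rw [hp0] at h2
    refine h2.trans (mul_le_mul_of_nonneg_right ?_ (hC T))
    linarith [hj' N s]
  -- Along an ultrafilter, bounded sequences in finite dimension converge at every time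
  -- simultaneously, without extracting subsequences.
  let l : Filter ℕ := hyperfilter ℕ
  have hl : Tendsto h l (𝓝 0) :=
    tendsto_one_div_add_atTop_nhds_zero_nat.mono_left Nat.hyperfilter_le_atTop
  have hjl : ∀ t, 0 ≤ t → Tendsto (fun N => (j N t : ℝ) * h N) l (𝓝 t) := by
    intro t ht
    refine tendsto_of_tendsto_of_tendsto_of_le_of_le (g := fun N => t - h N) (h := fun _ => t)
      (by simpa using tendsto_const_nhds.sub hl) tendsto_const_nhds (fun N => ?_)
      (fun N => hj N t ht)
    have := hj' N t
    simp only
    linarith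
  have hlim : ∀ t : ℝ, ∃ y, 0 ≤ t → Tendsto (fun N => p N (j N t)) l (𝓝 y) := by
    intro t
    rcases lt_or_ge t 0 with ht | ht
    · exact ⟨0, fun h0 => absurd h0 ht.not_ge⟩
    have hmem : ∀ N, p N (j N t) ∈ Metric.closedBall x₀ ((t + 1) * C t) := by
      intro N
      have h1 := hlip N 0 t t le_rfl ht le_rfl
      have h0 : j N 0 = 0 := by simp [j]
      have hN : h N ≤ 1 := by
        have : (0 : ℝ) ≤ N := by positivity
        simp only [h]
        rw [div_le_one (by positivity)]; linarith
      rw [h0, hp0] at h1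
      rw [mem_closedBall_iff_norm]
      exact h1.trans (mul_le_mul_of_nonneg_right (by linarith) (hC t))
    obtain ⟨y, -, hy⟩ := (isCompact_closedBall x₀ ((t + 1) * C t)).ultrafilter_le_nhds
      ((hyperfilter ℕ).map fun N => p N (j N t))
      (le_principal_iff.2 (Filter.mem_map.2 (Eventually.of_forall hmem)))
    exact ⟨y, fun _ => hy⟩
  choose x hx using hlim
  have hΦlim : ∀ t, 0 ≤ t →
      Tendsto (fun N => Φ (p N (j N t)) (j N t * h N)) l (𝓝 (Φ (x t) t)) := by
    intro t ht
    rw [tendsto_iff_norm_sub_tendsto_zero]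
    refine squeeze_zero (fun _ => norm_nonneg _)
      (fun N => hΦ _ _ _ _ (mul_nonneg (Nat.cast_nonneg _) (hpos N).le) ht) ?_
    have h1 := (tendsto_iff_norm_sub_tendsto_zero.1 (hx t ht)).const_mul β
    have h2 := (tendsto_iff_norm_sub_tendsto_zero.1 (hjl t ht)).const_mul γ
    simpa using h1.add h2
  refine ⟨x, ?_, fun T => ⟨(C T).toNNReal, ?_⟩, fun t ht => ?_, fun t ht z hz => ?_⟩
  · have h1 := hx 0 le_rfl
    have h2 : (fun N => p N (j N 0)) = fun _ => x₀ := by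
      funext N; simp [j, hp0]
    rw [h2] at h1
    exact tendsto_nhds_unique h1 tendsto_const_nhds
  · have key : ∀ s ∈ Icc 0 T, ∀ t ∈ Icc 0 T, s ≤ t → dist (x s) (x t) ≤ C T * dist s t := by
      intro s hs t ht hst
      rw [dist_comm, dist_comm s, dist_eq_norm, Real.dist_eq, abs_of_nonneg (sub_nonneg.2 hst),
        mul_comm]
      have h1 := ((hl.const_add (t - s)).mul_const (C T))
      rw [add_zero] at h1
      exact le_of_tendsto_of_tendsto' ((hx t ht.1).sub (hx s hs.1)).norm h1
        fun N => hlip N s t T hs.1 hst ht.2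
    refine LipschitzOnWith.of_dist_le_mul fun s hs t ht => ?_
    rw [Real.coe_toNNReal _ (hC T)]
    rcases le_total s t with hst | hst
    · exact key s hs t ht hst
    · rw [dist_comm, dist_comm s]; exact key t ht s hs hst
  -- The iterates lie in the set at the grid time, so they are first moved into `X t`, at vanishing
  -- cost.
  · choose w hw hwd using fun N => hX (j N t * h N) t
      (mul_nonneg (Nat.cast_nonneg _) (hpos N).le) ht _ ((hp N).mem (j N t))
    refine (hcl t).mem_of_tendsto (b := l) (f := w) ?_ (Eventually.of_forall hw)
    have h1 : Tendsto (fun N => w N - p N (j N t)) l (𝓝 0) := by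
      refine squeeze_zero_norm hwd ?_
      have h2 := (tendsto_iff_norm_sub_tendsto_zero.1 (hjl t ht)).const_mul κ
      simpa [abs_sub_comm] using h2
    simpa using h1.add (hx t ht)
  · let T := t + 1
    refine ⟨2 * C T * (κ + C T) + (β * C T + γ) * ‖z - x t‖, fun δ hδ hδ1 => ?_⟩
    have htδ : 0 ≤ t + δ := add_nonneg ht hδ
    have h1 : ∀ N, _ := fun N => (hp N).inner_sub_ge hX hΦ hκ hβ hγ (hpos N).le (T := T)
      (hjmono N t (t + δ) (by linarith)) ht hδ (by simp only [T]; linarith) (hj' N t)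
      (hj N _ htδ) hz
    simp only [hp0] at h1
    have hd := (hjl (t + δ) htδ).sub (hjl t ht)
    rw [add_sub_cancel_left] at hd
    have hz' : Tendsto (fun N => z - p N (j N t)) l (𝓝 (z - x t)) := (hx t ht).const_sub z
    have hL := ((hd.mul (hl.const_add δ)).mul
      ((hz'.norm.const_mul (β * C T + γ)).const_add (2 * C T * (κ + C T)))).neg
    have hR := (((hx _ htδ).sub (hx t ht)).sub (hd.smul (hΦlim t ht))).inner (𝕜 := ℝ) hz'
    have := le_of_tendsto_of_tendsto' hL hR h1
    rwa [add_zero, ← pow_two] at this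

end Limit

/-! ### Polyhedra: normal vectors and the Hoffman bound. -/

section Polyhedron

variable {m n : ℕ}

lemma isClosed_polyhedron (U : Matrix (Fin m) (Fin n) ℝ) (b : EuclideanSpace ℝ (Fin m)) :
    IsClosed (polyhedron U b) := by
  rw [polyhedron, ofPred_forall]
  refine isClosed_iInter fun i => isClosed_le ?_ continuous_const
  simp only [Matrix.mulVec, dotProduct]
  fun_prop

lemma convex_polyhedron (U : Matrix (Fin m) (Fin n) ℝ) (b : EuclideanSpace ℝ (Fin m)) :
    Convex ℝ (polyhedron U b) := by
  intro x hx y hy r s hr hs hrs i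
  have h1 := mul_le_mul_of_nonneg_left (hx i) hr
  have h2 := mul_le_mul_of_nonneg_left (hy i) hs
  have h3 : b i = r * b i + s * b i := by rw [← add_mul, hrs, one_mul]
  rw [h3]
  simpa [Matrix.mulVec_add, Matrix.mulVec_smul] using add_le_add h1 h2

/-- A direction along which no active constraint increases is feasible for a short time. -/
lemma exists_pos_add_smul_mem_polyhedron {U : Matrix (Fin m) (Fin n) ℝ}
    {b : EuclideanSpace ℝ (Fin m)} {z d : EuclideanSpace ℝ (Fin n)} (hz : z ∈ polyhedron U b)
    (hd : ∀ i ∈ activeSet U b z, (U *ᵥ d.ofLp) i ≤ 0) :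
    ∃ ε : ℝ, 0 < ε ∧ z + ε • d ∈ polyhedron U b := by
  have key : ∀ i, ∀ᶠ ε : ℝ in 𝓝[>] 0, (U *ᵥ (z + ε • d).ofLp) i ≤ b i := by
    intro i
    have e : ∀ ε : ℝ, (U *ᵥ (z + ε • d).ofLp) i = (U *ᵥ z.ofLp) i + ε * (U *ᵥ d.ofLp) i := by
      intro ε; simp [Matrix.mulVec_add, Matrix.mulVec_smul]
    simp only [e]
    by_cases hi : i ∈ activeSet U b z
    · filter_upwards [self_mem_nhdsWithin] with ε hε
      have h1 : (U *ᵥ z.ofLp) i = b i := hi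
      have := mul_nonpos_of_nonneg_of_nonpos (le_of_lt hε) (hd i hi)
      linarith
    · have hlt : (U *ᵥ z.ofLp) i < b i := lt_of_le_of_ne (hz i) hi
      have hc : Tendsto (fun ε : ℝ => (U *ᵥ z.ofLp) i + ε * (U *ᵥ d.ofLp) i) (𝓝[>] 0)
          (𝓝 ((U *ᵥ z.ofLp) i)) := by
        have : Continuous fun ε : ℝ => (U *ᵥ z.ofLp) i + ε * (U *ᵥ d.ofLp) i := by fun_prop
        simpa using (this.tendsto 0).mono_left nhdsWithin_le_nhds
      exact (hc.eventually_lt_const hlt).mono fun _ => le_of_lt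
  obtain ⟨ε, hε, hε0⟩ := ((eventually_all.2 key).and self_mem_nhdsWithin).exists
  exact ⟨ε, hε0, hε⟩

/-- Normal vectors of a polyhedron are non-negative combinations of the active rows, when these
are linearly independent. -/
lemma exists_multiplier {U : Matrix (Fin m) (Fin n) ℝ} {b : EuclideanSpace ℝ (Fin m)}
    {z η : EuclideanSpace ℝ (Fin n)} [Fintype (activeSet U b z)] (hz : z ∈ polyhedron U b)
    (hG : (rowSubmatrix U (activeSet U b z) * (rowSubmatrix U (activeSet U b z))ᵀ).PosDef)
    (hη : ∀ y ∈ polyhedron U b, inner ℝ η (y - z) ≤ 0) :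
    ∃ c : activeSet U b z → ℝ, (∀ i, 0 ≤ c i) ∧
      η.ofLp = (rowSubmatrix U (activeSet U b z))ᵀ *ᵥ c := by
  classical
  set A := rowSubmatrix U (activeSet U b z) with hA
  have hdir : ∀ d : Fin n → ℝ, (∀ i, (A *ᵥ d) i ≤ 0) → η.ofLp ⬝ᵥ d ≤ 0 := by
    intro d hd
    obtain ⟨ε, hε, hmem⟩ := exists_pos_add_smul_mem_polyhedron (d := WithLp.toLp 2 d) hz
      (fun i hi => hd ⟨i, hi⟩)
    have h1 := hη _ hmem
    rw [add_sub_cancel_left, inner_smul_right] at h1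
    have h2 := nonpos_of_mul_nonpos_right h1 hε
    simpa [PiLp.inner_apply, dotProduct, mul_comm] using h2
  have hdet : IsUnit (A * Aᵀ).det := (Matrix.isUnit_iff_isUnit_det _).1 hG.isUnit
  -- Least-squares coefficients of `η` on the active rows. The residual lies in the kernel of `A`,
  -- hence is a feasible direction, and testing `η` against it shows that it vanishes.
  set c := (A * Aᵀ)⁻¹ *ᵥ (A *ᵥ η.ofLp) with hc
  have hAc : A *ᵥ (Aᵀ *ᵥ c) = A *ᵥ η.ofLp := by
    rw [hc, Matrix.mulVec_mulVec, Matrix.mulVec_mulVec, Matrix.mul_nonsing_inv _ hdet,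
      Matrix.one_mulVec]
  have hηc : η.ofLp = Aᵀ *ᵥ c := by
    set d := η.ofLp - Aᵀ *ᵥ c with hd
    have hAd : A *ᵥ d = 0 := by rw [hd, Matrix.mulVec_sub, hAc, sub_self]
    have h1 := hdir d (fun i => by simp [hAd])
    have h2 : (Aᵀ *ᵥ c) ⬝ᵥ d = 0 := by
      rw [Matrix.mulVec_transpose, ← Matrix.dotProduct_mulVec, hAd, dotProduct_zero]
    have h3 : d ⬝ᵥ d ≤ 0 := by
      conv_lhs => rw [hd, sub_dotProduct, ← hd, h2, sub_zero]
      exact h1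
    have h4 : 0 ≤ d ⬝ᵥ d := Finset.sum_nonneg fun i _ => mul_self_nonneg _
    exact sub_eq_zero.1 (dotProduct_self_eq_zero.1 (le_antisymm h3 h4))
  refine ⟨c, fun i => ?_, hηc⟩
  -- This direction relaxes constraint `i` alone; its pairing with `η` is `-c i`.
  have hAe : A *ᵥ (Aᵀ *ᵥ ((A * Aᵀ)⁻¹ *ᵥ Pi.single i (-1))) = Pi.single i (-1) := by
    rw [Matrix.mulVec_mulVec, Matrix.mulVec_mulVec, Matrix.mul_nonsing_inv _ hdet,
      Matrix.one_mulVec]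
  have h1 := hdir (Aᵀ *ᵥ ((A * Aᵀ)⁻¹ *ᵥ Pi.single i (-1))) (fun k => by
    rw [hAe]
    by_cases hk : k = i
    · subst hk; simp
    · simp [hk])
  rw [hηc, Matrix.mulVec_transpose, ← Matrix.dotProduct_mulVec, hAe] at h1
  simpa using h1

/-- A Hoffman bound for the right-hand side of a polyhedron with uniformly independent active
rows. -/
lemma exists_mem_polyhedron_norm_sub_le {U : Matrix (Fin m) (Fin n) ℝ}
    {a b : EuclideanSpace ℝ (Fin m)} {ω : ℝ} (hω : 0 < ω)
    (hU : ∀ x ∈ polyhedron U b,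
      (rowSubmatrix U (activeSet U b x) * (rowSubmatrix U (activeSet U b x))ᵀ -
        ω ^ 2 • (1 : Matrix (activeSet U b x) (activeSet U b x) ℝ)).PosSemidef)
    (hne : (polyhedron U b).Nonempty) {x : EuclideanSpace ℝ (Fin n)} (hx : x ∈ polyhedron U a) :
    ∃ z ∈ polyhedron U b, ‖z - x‖ ≤ ‖b - a‖ / ω := by
  classical
  obtain ⟨z, hz, -, hvar⟩ := exists_nearest_point hne (isClosed_polyhedron U b)
    (convex_polyhedron U b) x
  refine ⟨z, hz, ?_⟩
  set A := rowSubmatrix U (activeSet U b z) with hA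
  have hpsd := hU z hz
  have hG : (A * Aᵀ).PosDef := by
    have h1 : (ω ^ 2 • (1 : Matrix (activeSet U b z) (activeSet U b z) ℝ)).PosDef :=
      Matrix.PosDef.one.smul (by positivity)
    have := h1.add_posSemidef hpsd
    simpa using this
  obtain ⟨c, hc0, hc⟩ := exists_multiplier hz hG hvar
  have hsq : ‖x - z‖ ^ 2 = (x - z).ofLp ⬝ᵥ (x - z).ofLp := by
    rw [EuclideanSpace.real_norm_sq_eq]; simp [dotProduct, pow_two]
  have hlow : ω ^ 2 * (c ⬝ᵥ c) ≤ ‖x - z‖ ^ 2 := by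
    have h1 := hpsd.dotProduct_mulVec_nonneg c
    rw [Matrix.sub_mulVec, Matrix.smul_mulVec, Matrix.one_mulVec, dotProduct_sub,
      dotProduct_smul] at h1
    have h2 : c ⬝ᵥ ((A * Aᵀ) *ᵥ c) = ‖x - z‖ ^ 2 := by
      rw [hsq, hc, ← Matrix.mulVec_mulVec, Matrix.dotProduct_mulVec, ← Matrix.mulVec_transpose]
    simp only [star_trivial, smul_eq_mul] at h1
    linarith
  -- Active constraints are equalities at `z`, so `A (x - z)` is at most `a - b` on them; then
  -- Cauchy–Schwarz.
  have hup : ‖x - z‖ ^ 2 ≤ Real.sqrt (c ⬝ᵥ c) * ‖b - a‖ := by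
    have h1 : ‖x - z‖ ^ 2 = ∑ i, c i * (A *ᵥ (x - z).ofLp) i := by
      rw [hsq]
      nth_rewrite 1 [hc]
      rw [Matrix.mulVec_transpose, ← Matrix.dotProduct_mulVec]
      rfl
    have h2 : ∀ i, c i * (A *ᵥ (x - z).ofLp) i ≤ c i * (a - b) i.1 := by
      intro i
      refine mul_le_mul_of_nonneg_left ?_ (hc0 i)
      have e1 : (A *ᵥ (x - z).ofLp) i = (U *ᵥ x.ofLp) i - (U *ᵥ z.ofLp) i := by
        have : (A *ᵥ (x - z).ofLp) i = (U *ᵥ (x - z).ofLp) i := rfl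
        rw [this]; simp [Matrix.mulVec_sub]
      have e2 : (U *ᵥ z.ofLp) i = b i := i.2
      rw [e1, e2]
      simpa using hx i
    have h3 : ∑ i : activeSet U b z, (a - b) i.1 ^ 2 ≤ ‖b - a‖ ^ 2 := by
      rw [norm_sub_rev, EuclideanSpace.real_norm_sq_eq]
      rw [← Finset.sum_image (f := fun i => (a - b) i ^ 2) (s := Finset.univ)
        (g := (Subtype.val : activeSet U b z → Fin m)) (fun _ _ _ _ h => Subtype.ext h)]
      exact Finset.sum_le_univ_sum_of_nonneg fun i => sq_nonneg _
    calc ‖x - z‖ ^ 2 ≤ ∑ i, c i * (a - b) i.1 := by rw [h1]; exact Finset.sum_le_sum fun i _ => h2 i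
      _ ≤ Real.sqrt (∑ i, c i ^ 2) * Real.sqrt (∑ i : activeSet U b z, (a - b) i.1 ^ 2) :=
        Real.sum_mul_le_sqrt_mul_sqrt _ _ _
      _ ≤ Real.sqrt (c ⬝ᵥ c) * ‖b - a‖ := by
        gcongr
        · simp [dotProduct, pow_two]
        · exact Real.sqrt_le_iff.2 ⟨norm_nonneg _, h3⟩
  have hroot : ω * Real.sqrt (c ⬝ᵥ c) ≤ ‖x - z‖ := by
    have h0 : 0 ≤ c ⬝ᵥ c := Finset.sum_nonneg fun i _ => mul_self_nonneg _
    refine le_of_sq_le_sq ?_ (norm_nonneg _)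
    rw [mul_pow, Real.sq_sqrt h0]
    exact hlow
  rw [le_div_iff₀ hω, norm_sub_rev]
  rcases eq_or_lt_of_le (norm_nonneg (x - z)) with h0 | h0
  · rw [← h0]; simp
  · have h4 : ‖x - z‖ * (‖x - z‖ * ω) ≤ ‖x - z‖ * ‖b - a‖ := by
      have h5 := mul_le_mul_of_nonneg_left hup hω.le
      have h6 := mul_le_mul_of_nonneg_right hroot (norm_nonneg (b - a))
      nlinarith
    exact le_of_mul_le_mul_left h4 h0

end Polyhedron

end Sweeping

/-! ### Uniqueness by Grönwall. -/

/-- An absolutely continuous function with a.e. non-positive derivative does not increase. -/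
lemma AbsolutelyContinuousOnInterval.le_of_ae_deriv_nonpos {g : ℝ → ℝ} {a b : ℝ} (hab : a ≤ b)
    (hg : AbsolutelyContinuousOnInterval g a b) (hd : ∀ᵐ t, t ∈ Ioc a b → deriv g t ≤ 0) :
    g b ≤ g a := by
  have h1 := hg.integral_deriv_eq_sub
  have h2 : ∫ t in a..b, deriv g t ≤ 0 := by
    rw [intervalIntegral.integral_of_le hab]
    exact integral_nonpos_of_ae ((ae_restrict_iff' measurableSet_Ioc).2 hd)
  linarith

lemma AbsolutelyContinuousOnInterval.norm_sq {E : Type*} [SeminormedAddCommGroup E] {g : ℝ → E}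
    {a b : ℝ} (hg : AbsolutelyContinuousOnInterval g a b) :
    AbsolutelyContinuousOnInterval (fun t => ‖g t‖ ^ 2) a b := by
  have h : AbsolutelyContinuousOnInterval (fun t => ‖g t‖) a b := by
    refine squeeze_zero (fun _ => Finset.sum_nonneg fun _ _ => dist_nonneg) (fun I => ?_) hg
    exact Finset.sum_le_sum fun i _ => by
      rw [dist_eq_norm (g _)]; exact dist_norm_norm_le _ _
  simpa only [pow_two] using h.fun_mul h

namespace Sweeping

open Filter Topology

variable {n : ℕ}

/-- The closure in `normalCone` adds nothing: each inequality defines a closed set. -/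
lemma inner_nonpos_of_mem_normalCone {X : Set (EuclideanSpace ℝ (Fin n))}
    {x η y : EuclideanSpace ℝ (Fin n)} (hη : η ∈ normalCone X x) (hy : y ∈ X) :
    inner ℝ η (y - x) ≤ 0 := by
  have hcl : IsClosed {η : EuclideanSpace ℝ (Fin n) | inner ℝ η (y - x) ≤ 0} :=
    isClosed_le (by fun_prop) continuous_const
  exact closure_minimal (fun _ h => mem_ofPred_eq ▸ h y hy) hcl hη

/-- Two solutions of a sweeping process with Lipschitz perturbation and the same initial value
agree. -/
lemma IsSolution.eq_of_eq {Φ : EuclideanSpace ℝ (Fin n) → ℝ → EuclideanSpace ℝ (Fin n)}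
    {X : ℝ → Set (EuclideanSpace ℝ (Fin n))} {T β : ℝ} (hT : 0 ≤ T)
    (hΦ : ∀ x y t, ‖Φ x t - Φ y t‖ ≤ β * ‖x - y‖) {x y : ℝ → EuclideanSpace ℝ (Fin n)}
    (hx : IsSolution Φ X T x) (hy : IsSolution Φ X T y) (h0 : x 0 = y 0) : x T = y T := by
  -- The exponential weight cancels the growth rate `2 * β`, so `g` is nonincreasing.
  let g : ℝ → ℝ := fun t => ‖x t - y t‖ ^ 2 * Real.exp (-(2 * β) * t)
  have hexp : AbsolutelyContinuousOnInterval (fun t : ℝ => Real.exp (-(2 * β) * t)) 0 T :=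
    ContDiffOn.absolutelyContinuousOnInterval (by fun_prop)
  have hg : AbsolutelyContinuousOnInterval g 0 T :=
    (hx.absolutelyContinuous.fun_sub hy.absolutelyContinuous).norm_sq.fun_mul hexp
  have hd : ∀ᵐ t, t ∈ Ioc 0 T → deriv g t ≤ 0 := by
    have hx' := (ae_restrict_iff' measurableSet_Icc).1 hx.inclusion
    have hy' := (ae_restrict_iff' measurableSet_Icc).1 hy.inclusion
    have hT' : ∀ᵐ t : ℝ, t ≠ T := by simp [ae_iff, measure_singleton]
    filter_upwards [hx', hy', hT'] with t hx1 hy1 htT ht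
    have htI : t ∈ Icc 0 T := Ioc_subset_Icc_self ht
    have hnhds : Icc 0 T ∈ 𝓝 t := Icc_mem_nhds ht.1 (lt_of_le_of_ne ht.2 htT)
    obtain ⟨η, hη, hxd⟩ := hx1 htI
    obtain ⟨ζ, hζ, hyd⟩ := hy1 htI
    have hD := ((hxd.hasDerivAt hnhds).sub (hyd.hasDerivAt hnhds)).norm_sq
    have hE : HasDerivAt (fun t : ℝ => Real.exp (-(2 * β) * t))
        (Real.exp (-(2 * β) * t) * (-(2 * β))) t := by
      simpa using ((hasDerivAt_id t).const_mul (-(2 * β))).exp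
    have hG : HasDerivAt g _ t := hD.mul hE
    rw [hG.deriv]
    have h1 := inner_nonpos_of_mem_normalCone hη (hy.mem t htI)
    have h2 := inner_nonpos_of_mem_normalCone hζ (hx.mem t htI)
    have h3 : inner ℝ (x t - y t) (Φ (x t) t - Φ (y t) t) ≤ β * ‖x t - y t‖ ^ 2 := by
      refine (real_inner_le_norm _ _).trans ?_
      rw [pow_two, ← mul_assoc, mul_comm]
      exact mul_le_mul_of_nonneg_right (hΦ _ _ _) (norm_nonneg _)
    -- Monotonicity: each solution is a test point for the other's normal vector.
    have h4 : inner ℝ (x t - y t) (Φ (x t) t - η - (Φ (y t) t - ζ)) =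
        inner ℝ (x t - y t) (Φ (x t) t - Φ (y t) t) + inner ℝ η (y t - x t)
          + inner ℝ ζ (x t - y t) := by
      rw [real_inner_comm (y t - x t), real_inner_comm (x t - y t) ζ, ← neg_sub (x t) (y t),
        inner_neg_left, ← sub_eq_add_neg, ← inner_sub_right, ← inner_add_right]
      congr 1; abel
    have h5 : 2 * inner ℝ (x t - y t) (Φ (x t) t - η - (Φ (y t) t - ζ))
        - 2 * β * ‖x t - y t‖ ^ 2 ≤ 0 := by linarith
    have h6 := mul_nonpos_of_nonneg_of_nonpos (Real.exp_pos (-(2 * β) * t)).le h5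
    simp only [Pi.sub_apply]
    linarith
  have hle := hg.le_of_ae_deriv_nonpos hT hd
  have h7 : ‖x T - y T‖ ^ 2 ≤ 0 := by
    have e : g 0 = 0 := by simp [g, h0]
    rw [e] at hle
    exact nonpos_of_mul_nonpos_left hle (Real.exp_pos _)
  have h8 : ‖x T - y T‖ = 0 := pow_eq_zero_iff (two_ne_zero) |>.1 (le_antisymm h7 (sq_nonneg _))
  exact sub_eq_zero.1 (norm_eq_zero.1 h8)

/-! ### Existence for Lipschitz moving convex sets. -/

/-- Existence for the sweeping process with a Lipschitz perturbation and a Lipschitz moving convex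
set. -/
theorem exists_isCompleteSolution {Φ : EuclideanSpace ℝ (Fin n) → ℝ → EuclideanSpace ℝ (Fin n)}
    {X : ℝ → Set (EuclideanSpace ℝ (Fin n))} {κ β γ : ℝ}
    (hX : MovesWithSpeed X κ) (hcl : ∀ t, IsClosed (X t)) (hcv : ∀ t, Convex ℝ (X t))
    (hΦ : IsLipschitzField Φ β γ) (hκ : 0 ≤ κ) (hβ : 0 ≤ β) (hγ : 0 ≤ γ)
    {x₀ : EuclideanSpace ℝ (Fin n)} (hx₀ : x₀ ∈ X 0) :
    ∃ x, IsCompleteSolution Φ X x ∧ x 0 = x₀ := by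
  obtain ⟨x, hx0, hlip, hmem, hineq⟩ := exists_limit_of_catchingUp hX hcl hcv hΦ hκ hβ hγ hx₀
  refine ⟨x, fun T hT => ?_, hx0⟩
  obtain ⟨C, hC⟩ := hlip T
  refine ⟨LipschitzOnWith.absolutelyContinuousOnInterval (by rwa [uIcc_of_le hT.le]), ?_,
    fun t ht => hmem t ht.1⟩
  rw [ae_restrict_iff' measurableSet_Icc]
  have h0' : ∀ᵐ t : ℝ, t ≠ 0 := by simp [ae_iff, measure_singleton]
  have hT' : ∀ᵐ t : ℝ, t ≠ T := by simp [ae_iff, measure_singleton]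
  filter_upwards [hC.ae_differentiableWithinAt_of_mem_real, h0', hT'] with t hdiff ht0 htT ht
  set D := derivWithin x (Icc 0 T) t with hD
  have hderiv : HasDerivWithinAt x D (Icc 0 T) t := (hdiff ht).hasDerivWithinAt
  refine ⟨Φ (x t) t - D, subset_closure fun z hz => ?_, by rwa [sub_sub_cancel]⟩
  have hderivAt : HasDerivAt x D t := hderiv.hasDerivAt
    (Icc_mem_nhds (lt_of_le_of_ne ht.1 ht0.symm) (lt_of_le_of_ne ht.2 htT))
  obtain ⟨M, hM⟩ := hineq t ht.1 z hz
  -- The integrated inequality looks forward in time only; right difference quotients suffice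
  -- because the derivative exists.
  have hslope : Tendsto (fun δ : ℝ => δ⁻¹ • (x (t + δ) - x t)) (𝓝[>] 0) (𝓝 D) :=
    (hasDerivAt_iff_tendsto_slope_zero.1 hderivAt).mono_left
      (nhdsWithin_mono _ fun δ (hδ : 0 < δ) => hδ.ne')
  have hR : Tendsto (fun δ : ℝ => inner ℝ (δ⁻¹ • (x (t + δ) - x t) - Φ (x t) t) (z - x t))
      (𝓝[>] 0) (𝓝 (inner ℝ (D - Φ (x t) t) (z - x t))) :=
    (hslope.sub_const _).inner tendsto_const_nhds
  have hL : Tendsto (fun δ : ℝ => -(δ * M)) (𝓝[>] 0) (𝓝 0) := by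
    have : Continuous fun δ : ℝ => -(δ * M) := by fun_prop
    simpa using (this.tendsto 0).mono_left nhdsWithin_le_nhds
  have hle : 0 ≤ inner ℝ (D - Φ (x t) t) (z - x t) := by
    refine le_of_tendsto_of_tendsto hL hR ?_
    filter_upwards [Ioc_mem_nhdsGT (zero_lt_one' ℝ)] with δ hδ
    have h1 := mul_le_mul_of_nonneg_left (hM δ hδ.1.le hδ.2) (inv_pos.2 hδ.1).le
    have hne : δ ≠ 0 := hδ.1.ne'
    rw [← real_inner_smul_left, smul_sub _ (x (t + δ) - x t), inv_smul_smul₀ hne] at h1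
    refine le_trans (le_of_eq ?_) h1
    field_simp
  rw [← neg_sub D, inner_neg_left]
  linarith

end Sweeping

/-! ### The sweeping gradient flow. -/

theorem mainTheorem9 {n m : ℕ}
    (f : EuclideanSpace ℝ (Fin n) → ℝ) (α : ℝ) (β : ℝ≥0)
    (hα : 0 < α) (hf : ContDiff ℝ 2 f) (hf_convex : StrongConvexOn univ α f)
    (hf_lip : LipschitzWith β (∇ f))
    (c : ℝ → EuclideanSpace ℝ (Fin n)) (ℓc : ℝ≥0) (hc : LipschitzOnWith ℓc c (Ici 0))
    (v : ℝ → EuclideanSpace ℝ (Fin m)) (ℓv : ℝ≥0) (hv : LipschitzOnWith ℓv v (Ici 0))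
    (U : Matrix (Fin m) (Fin n) ℝ) (ω : ℝ) (hω : 0 < ω)
    (hU : ∀ t : ℝ, 0 ≤ t → ∀ x ∈ Sweeping.polyhedron U (v t),
      (Sweeping.rowSubmatrix U (Sweeping.activeSet U (v t) x) *
          (Sweeping.rowSubmatrix U (Sweeping.activeSet U (v t) x))ᵀ -
        ω ^ 2 • (1 : Matrix (Sweeping.activeSet U (v t) x)
          (Sweeping.activeSet U (v t) x) ℝ)).PosSemidef)
    (hne : ∀ t : ℝ, 0 ≤ t → (Sweeping.polyhedron U (v t)).Nonempty)
    (x₀ : EuclideanSpace ℝ (Fin n)) (hx₀ : x₀ ∈ Sweeping.polyhedron U (v 0)) :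
    ∃ x : ℝ → EuclideanSpace ℝ (Fin n),
      (Sweeping.IsCompleteSolution (fun z t => -∇ f (z - c t))
          (fun t => Sweeping.polyhedron U (v t)) x ∧ x 0 = x₀) ∧
      ∀ y : ℝ → EuclideanSpace ℝ (Fin n),
        Sweeping.IsCompleteSolution (fun z t => -∇ f (z - c t))
          (fun t => Sweeping.polyhedron U (v t)) y → y 0 = x₀ →
        EqOn y x (Ici 0) := by

  have hlip : Sweeping.IsLipschitzField (fun z t => -∇ f (z - c t)) β (β * ℓc) := by
    intro x y s t hs ht
    have h1 := hf_lip.norm_sub_le (y - c t) (x - c s)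
    have h2 := hc.norm_sub_le ht hs
    have h3 : ‖y - c t - (x - c s)‖ ≤ ‖x - y‖ + ℓc * |s - t| := by
      calc ‖y - c t - (x - c s)‖ = ‖(y - x) - (c t - c s)‖ := by congr 1; abel
        _ ≤ ‖y - x‖ + ‖c t - c s‖ := norm_sub_le _ _
        _ ≤ _ := by
          rw [norm_sub_rev x y, abs_sub_comm]
          exact add_le_add le_rfl h2
    calc ‖-∇ f (x - c s) - -∇ f (y - c t)‖ = ‖∇ f (y - c t) - ∇ f (x - c s)‖ := by
          congr 1; abel
      _ ≤ β * (‖x - y‖ + ℓc * |s - t|) := h1.trans (mul_le_mul_of_nonneg_left h3 β.2)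
      _ = _ := by ring
  have hmove : Sweeping.MovesWithSpeed (fun t => Sweeping.polyhedron U (v t)) (ℓv / ω) := by
    intro s t hs ht x hx
    obtain ⟨z, hz, hzx⟩ :=
      Sweeping.exists_mem_polyhedron_norm_sub_le hω (hU t ht) (hne t ht) hx
    refine ⟨z, hz, hzx.trans ?_⟩
    rw [div_mul_eq_mul_div]
    exact div_le_div_of_nonneg_right (hv.norm_sub_le ht hs) hω.le
  obtain ⟨x, hx, hx0⟩ := Sweeping.exists_isCompleteSolution hmove
    (fun t => Sweeping.isClosed_polyhedron U (v t)) (fun t => Sweeping.convex_polyhedron U (v t))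
    hlip (by positivity) β.2 (by positivity) hx₀
  refine ⟨x, ⟨hx, hx0⟩, fun y hy hy0 t ht => ?_⟩
  -- Complete solutions are tested only on intervals with `T > 0`, so time zero comes from the
  -- initial condition.
  rcases eq_or_lt_of_le (mem_Ici.1 ht) with rfl | htpos
  · rw [hy0, hx0]
  · refine (hy t htpos).eq_of_eq (β := β) htpos.le (fun x y s => ?_) (hx t htpos)
      (hy0.trans hx0.symm)
    have h1 := hf_lip.norm_sub_le (y - c s) (x - c s)
    rw [sub_sub_sub_cancel_right, norm_sub_rev y x] at h1
    rwa [neg_sub_neg]
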